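/- For a prime $p>3$ define $h\in\{1,2,3,4,6,12\}$ by $h=1$ if $p\equiv 11,23$; $h=2$ if $p\equiv 5$; $h=3$ if $p\equiv 7,19$; $h=4$ if $p\equiv 17$; $h=6$ if $p\equiv 13$; $h=12$ if $p\equiv 1 \pmod{24}$. Let $\eta(z)=q^{1/24}\prod_{n\ge 1}(1-q^n)$ with $q=e^{2\pi i z}$, where $q^{1/24}=e^{2\pi i z/24}$; an $\eta$-quotient of level $p$ is a function on the upper half-plane of the form $\eta(z)^{r_1}\,\eta(pz)^{r_p}$ with $r_1,r_p\in\mathbb{Z}$. Let $p>3$ be a prime and let $k$ be an integer divisible by $h$. If $$\frac{p-1}{2h}\;\le\;\frac{k(p+1)}{12},$$ then the space $M_k(\Gamma_1(p))$ of modular forms of weight $k$ for $\Gamma_1(p)$ contains at least one $\eta$-quotient of level $p$. -/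

import Mathlib

open scoped UpperHalfPlane MatrixGroups

/-- The integer `h` such that the weight of an eta-quotient of prime level `p` has to be divisible
by `h`; it depends only on the class of `p` modulo `24`. Every prime lies in one of the listed
classes; the last value is never used. -/
def weightDivisor (p : ℕ) : ℕ :=
  match p % 24 with
  | 1 => 12
  | 2 => 4
  | 3 => 3
  | 5 => 2
  | 7 => 3
  | 11 => 1
  | 13 => 6
  | 17 => 4
  | 19 => 3
  | 23 => 1
  | _ => 0

/-- The eta-quotient `z ↦ ∏_{δ ∣ N} η(δ z) ^ r δ` of level `N` with integer exponents `r`. -/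
noncomputable def etaQuotient (N : ℕ) (r : ℕ → ℤ) (z : ℍ) : ℂ :=
  ∏ δ ∈ N.divisors, ModularForm.eta ((δ : ℂ) * (z : ℂ)) ^ r δ

/-- A function on the upper half-plane is an eta-quotient of level `N ≥ 1`. -/
def IsEtaQuotient (N : ℕ) (f : ℍ → ℂ) : Prop :=
  1 ≤ N ∧ ∃ r : ℕ → ℤ, f = etaQuotient N r

/-! Consider `η(z)^r η(pz)^s` with `r + s = 2k`. It is invariant under `Γ₁(p)` once `24 ∣ r + ps`,
and its orders at the cusps `∞` and `0` are `(r + ps)/24` and `(pr + s)/24`, with sum `k(p + 1)/12`.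
The congruence is solvable in `s` because `h = gcd(12, (p - 1)/2)` divides `k`. Changing `s` by
`12/h` moves the order at `∞` by `L = (p - 1)/(2h)`, so these orders fill a residue class modulo
`L`. By hypothesis `L ≤ k(p + 1)/12`, so some choice makes both orders nonnegative
(`exists_eta_exponents`).

Invariance (`etaPair_slash_Gamma1`) rests on an explicit multiplier of `η` for odd `c > 0`
(`etaTransforms_of_odd`), obtained from the Euclidean algorithm and quadratic reciprocity.
Boundedness at the cusps (`isBoundedAtImInfty_etaPair_slash`) is checked on 24th powers, where `η`
becomes `Δ`. -/

/-! ### The multiplier of `η`. -/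

/-- The exponent of `e^{2πi/24}` in the multiplier of `η` at a matrix with odd lower left entry. -/
def etaExponent (a b c d : ℤ) : ℤ := (a + d) * c - b * d * (c ^ 2 - 1) - 3 * c

/-- The powers of the primitive 24th root of unity `e^{2πi/24}`. -/
noncomputable def zeta24 (n : ℤ) : ℂ := Complex.exp (2 * Real.pi * Complex.I / 24) ^ n

lemma zeta24_add (m n : ℤ) : zeta24 (m + n) = zeta24 m * zeta24 n :=
  zpow_add₀ (Complex.exp_ne_zero _) m n

lemma zeta24_eq_exp (n : ℤ) : zeta24 n = Complex.exp (2 * Real.pi * Complex.I * n / 24) := by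
  rw [zeta24, ← Complex.exp_int_mul]
  ring_nf

lemma zeta24_of_dvd {n : ℤ} (h : 24 ∣ n) : zeta24 n = 1 := by
  obtain ⟨m, rfl⟩ := h
  rw [zeta24_eq_exp, Complex.exp_eq_one_iff]
  exact ⟨m, by push_cast; ring⟩

lemma zeta24_congr {m n : ℤ} (h : 24 ∣ m - n) : zeta24 m = zeta24 n := by
  rw [← sub_add_cancel m n, zeta24_add, zeta24_of_dvd h, one_mul]

lemma zeta24_zpow (n r : ℤ) : zeta24 n ^ r = zeta24 (n * r) := by
  rw [zeta24, zeta24, zpow_mul]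

lemma zeta24_twelve_mul (n : ℕ) : zeta24 (12 * n) = (-1) ^ n := by
  rw [zeta24_eq_exp, ← Complex.exp_pi_mul_I, ← Complex.exp_nat_mul]
  push_cast
  ring_nf

lemma sqrt_I_eq_zeta24 : Complex.sqrt Complex.I = zeta24 3 := by
  rw [Complex.sqrt, Complex.cpow_def_of_ne_zero Complex.I_ne_zero, Complex.log_I, zeta24_eq_exp]
  push_cast
  ring_nf

lemma Complex.sqrt_mul_self (z : ℂ) : Complex.sqrt z * Complex.sqrt z = z := by
  rw [← sq]
  exact Complex.cpow_nat_inv_pow z (n := 2) two_ne_zero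

lemma Complex.sqrt_re_pos_im_pos {z : ℂ} (hz : 0 < z.im) :
    0 < (Complex.sqrt z).re ∧ 0 < (Complex.sqrt z).im := by
  have h0 : z ≠ 0 := by rintro rfl; simp at hz
  have h1 : |z.re| < ‖z‖ := Complex.abs_re_lt_norm.mpr hz.ne'
  have h2 := abs_lt.mp h1
  rw [Complex.sqrt, Complex.cpow_inv_two_re, Complex.cpow_inv_two_im_eq_sqrt hz.le]
  exact ⟨Real.sqrt_pos.mpr (by linarith), Real.sqrt_pos.mpr (by linarith)⟩

/-- The principal square root is multiplicative when two points and their product lie in the upper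
half-plane. -/
lemma Complex.sqrt_mul_of_im_pos {z w : ℂ} (hz : 0 < z.im) (hw : 0 < w.im) (hzw : 0 < (z * w).im) :
    Complex.sqrt (z * w) = Complex.sqrt z * Complex.sqrt w := by
  have h : Complex.sqrt (z * w) ^ 2 = (Complex.sqrt z * Complex.sqrt w) ^ 2 := by
    rw [mul_pow, sq, sq, sq, sqrt_mul_self, sqrt_mul_self, sqrt_mul_self]
  obtain h | h := sq_eq_sq_iff_eq_or_eq_neg.mp h
  · exact h
  -- The minus sign is impossible: a product of two points of the open first quadrant has positive
  -- imaginary part.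
  · have h1 := sqrt_re_pos_im_pos hz
    have h2 := sqrt_re_pos_im_pos hw
    have h3 := (sqrt_re_pos_im_pos hzw).2
    rw [h, neg_im, mul_im] at h3
    nlinarith [mul_pos h1.1 h2.2, mul_pos h1.2 h2.1]

lemma eta_add_intCast (z : ℂ) (n : ℤ) :
    ModularForm.eta (z + n) = zeta24 n * ModularForm.eta z := by
  have h1 : Function.Periodic.qParam 1 (z + n) = Function.Periodic.qParam 1 z := by
    rw [Function.Periodic.qParam, Function.Periodic.qParam, Complex.exp_eq_exp_iff_exists_int]
    exact ⟨n, by push_cast; ring⟩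
  have h2 : Function.Periodic.qParam 24 (z + n) = zeta24 n * Function.Periodic.qParam 24 z := by
    rw [Function.Periodic.qParam, Function.Periodic.qParam, zeta24_eq_exp, ← Complex.exp_add]
    push_cast
    ring_nf
  simp only [ModularForm.eta, ModularForm.eta_q, h1, h2, mul_assoc]

lemma eta_neg_inv {z : ℂ} (hz : 0 < z.im) :
    ModularForm.eta (-1 / z) = zeta24 (-3) * Complex.sqrt z * ModularForm.eta z := by
  have h := ModularForm.eta_comp_eq_csqrt_I_inv (show z ∈ UpperHalfPlane.upperHalfPlaneSet from hz)
  have h3 : zeta24 (-3) = (zeta24 3)⁻¹ := zpow_neg _ 3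
  simpa [sqrt_I_eq_zeta24, h3, mul_assoc] using h

lemma im_neg_one_div_pos {z : ℂ} (hz : 0 < z.im) : 0 < (-1 / z : ℂ).im := by
  have h0 : z ≠ 0 := by rintro rfl; simp at hz
  rw [neg_div, Complex.neg_im, one_div, Complex.inv_im, neg_div, neg_neg]
  exact div_pos hz (Complex.normSq_pos.mpr h0)

/-- Positivity of `c` and `d` keeps both factors and their product in the upper half-plane, so the
principal branch contributes no sign. -/
lemma sqrt_mul_eta_neg_inv {c d : ℤ} (hc : 0 < c) (hd : 0 < d) {w : ℂ} (hw : 0 < w.im) :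
    Complex.sqrt (c * (-1 / w) + d) * ModularForm.eta (-1 / w) =
      zeta24 (-3) * (Complex.sqrt (d * w - c) * ModularForm.eta w) := by
  have h0 : w ≠ 0 := by rintro rfl; simp at hw
  have hc' : (0 : ℝ) < c := by exact_mod_cast hc
  have hd' : (0 : ℝ) < d := by exact_mod_cast hd
  have h1 : 0 < (c * (-1 / w) + d : ℂ).im := by
    have := mul_pos hc' (im_neg_one_div_pos hw)
    rw [Complex.add_im, Complex.intCast_im, add_zero, ← Complex.ofReal_intCast,
      Complex.im_ofReal_mul]
    exact this
  have h2 : (c * (-1 / w) + d : ℂ) * w = d * w - c := by field_simp; ring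
  have h3 : 0 < ((c * (-1 / w) + d : ℂ) * w).im := by
    rw [h2, Complex.sub_im, Complex.intCast_im, sub_zero, ← Complex.ofReal_intCast,
      Complex.im_ofReal_mul]
    exact mul_pos hd' hw
  rw [eta_neg_inv hw, ← h2, Complex.sqrt_mul_of_im_pos h1 hw h3]
  ring

/-- The transformation law of `η` with its multiplier for a matrix with odd positive lower left
entry. -/
def EtaTransforms (a b c d : ℤ) : Prop :=
  ∀ z : ℂ, 0 < z.im → ModularForm.eta ((a * z + b) / (c * z + d)) =
    (jacobiSym d c.natAbs : ℂ) * zeta24 (etaExponent a b c d) *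
      (Complex.sqrt (c * z + d) * ModularForm.eta z)

/-- The exponents differ by `3(d - 1)(c + 1)`, a multiple of 12 for odd `c`, `d`. The resulting sign
is the one in quadratic reciprocity times `(-1/d)`. -/
lemma jacobiSym_mul_zeta24_reciprocity {a b c d : ℤ} (hdet : a * d - b * c = 1) (hc : 0 < c)
    (hd : 0 < d) (hc2 : Odd c) (hd2 : Odd d) :
    (jacobiSym d c.natAbs : ℂ) * zeta24 (etaExponent a b c d) * zeta24 (-3) =
      (jacobiSym (-c) d.natAbs : ℂ) * zeta24 (etaExponent b (-a) d (-c)) := by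
  have hE : etaExponent a b c d + -3 = 3 * ((d - 1) * (c + 1)) + etaExponent b (-a) d (-c) := by
    rw [etaExponent, etaExponent]
    linear_combination (c * d) * hdet
  rw [mul_assoc, ← zeta24_add, hE, zeta24_add, ← mul_assoc]
  congr 1
  lift c to ℕ using hc.le
  lift d to ℕ using hd.le
  obtain ⟨m, rfl⟩ : Odd c := by exact_mod_cast hc2
  obtain ⟨n, rfl⟩ : Odd d := by exact_mod_cast hd2
  have hz : (3 * (((2 * n + 1 : ℕ) : ℤ) - 1) * (((2 * m + 1 : ℕ) : ℤ) + 1)) =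
      12 * ((n * (m + 1) : ℕ) : ℤ) := by push_cast; ring
  have hodd (k : ℕ) : Odd (2 * k + 1) := odd_two_mul_add_one k
  rw [← mul_assoc, hz, zeta24_twelve_mul, Int.natAbs_natCast, Int.natAbs_natCast,
    jacobiSym.neg _ (hodd n), jacobiSym.quadratic_reciprocity (hodd n) (hodd m),
    ZMod.χ₄_eq_neg_one_pow (by omega)]
  have hk (k : ℕ) : (2 * k + 1) / 2 = k := by omega
  rw [hk, hk]
  push_cast
  rw [mul_right_comm, ← pow_add, show n * m + n * (m + 1) = 2 * (n * m) + n by ring, pow_add,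
    pow_mul, neg_one_sq, one_pow, one_mul]

/-- Right multiplication by `S`, that is, the substitution `z = -1/w`. -/
lemma etaTransforms_S_iff {a b c d : ℤ} (hdet : a * d - b * c = 1) (hc : 0 < c) (hd : 0 < d)
    (hc2 : Odd c) (hd2 : Odd d) : EtaTransforms b (-a) d (-c) ↔ EtaTransforms a b c d := by
  have hJ := jacobiSym_mul_zeta24_reciprocity hdet hc hd hc2 hd2
  have hmoeb {w : ℂ} (hw : 0 < w.im) :
      (a * (-1 / w) + b : ℂ) / (c * (-1 / w) + d) = (b * w + (-a : ℤ)) / (d * w + (-c : ℤ)) := by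
    have h0 : w ≠ 0 := by rintro rfl; simp at hw
    rw [← mul_div_mul_right _ _ h0]
    congr 1 <;> push_cast <;> field_simp <;> ring
  have key {w : ℂ} (hw : 0 < w.im) :
      (jacobiSym d c.natAbs : ℂ) * zeta24 (etaExponent a b c d) *
        (Complex.sqrt (c * (-1 / w) + d) * ModularForm.eta (-1 / w)) =
      (jacobiSym (-c) d.natAbs : ℂ) * zeta24 (etaExponent b (-a) d (-c)) *
        (Complex.sqrt (d * w + (-c : ℤ)) * ModularForm.eta w) := by
    rw [sqrt_mul_eta_neg_inv hc hd hw, ← mul_assoc, hJ]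
    push_cast
    rw [sub_eq_add_neg]
  constructor
  · intro h z hz
    have hw := im_neg_one_div_pos hz
    have h0 : z ≠ 0 := by rintro rfl; simp at hz
    have hzw : -1 / (-1 / z) = z := by field_simp
    have h1 := key hw
    have h2 := hmoeb hw
    rw [hzw] at h1 h2
    rw [h1, h2, h _ hw]
  · intro h w hw
    rw [← key hw, ← hmoeb hw, h _ (im_neg_one_div_pos hw)]

lemma Int.twentyFour_dvd_mul_sq_sub_one {c : ℤ} (hc : Odd c) : 24 ∣ c * (c ^ 2 - 1) := by
  have h3 : (3 : ℤ) ∣ c * (c ^ 2 - 1) := by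
    apply Int.dvd_of_emod_eq_zero
    have : c % 3 = 0 ∨ c % 3 = 1 ∨ c % 3 = 2 := by omega
    rcases this with h | h | h <;> simp [Int.mul_emod, Int.sub_emod, pow_two, h]
  have h8 : (8 : ℤ) ∣ c * (c ^ 2 - 1) := (Int.eight_dvd_sq_sub_one_of_odd hc).mul_left c
  omega

/-- Right multiplication by `T^n`: the Jacobi symbol depends only on `d` modulo `c`, and the
exponent grows by `n` modulo 24. -/
lemma EtaTransforms.add_mul {a b c d : ℤ} (h : EtaTransforms a b c d) (hdet : a * d - b * c = 1)
    (hc2 : Odd c) (n : ℤ) : EtaTransforms a (b + n * a) c (d + n * c) := by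
  intro z hz
  have hz' : 0 < (z + n).im := by simpa using hz
  have h1 := h (z + n) hz'
  have e1 : (a * (z + n) + b : ℂ) = a * z + (b + n * a : ℤ) := by push_cast; ring
  have e2 : (c * (z + n) + d : ℂ) = c * z + (d + n * c : ℤ) := by push_cast; ring
  rw [e1, e2, eta_add_intCast] at h1
  have hJ : jacobiSym (d + n * c) c.natAbs = jacobiSym d c.natAbs := by
    apply jacobiSym.mod_left'
    rw [Int.add_emod, Int.emod_eq_zero_of_dvd (Int.natAbs_dvd.mpr (dvd_mul_left c n))]
    simp
  have hE : zeta24 (etaExponent a (b + n * a) c (d + n * c)) =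
      zeta24 (etaExponent a b c d) * zeta24 n := by
    rw [← zeta24_add]
    apply zeta24_congr
    have : etaExponent a (b + n * a) c (d + n * c) - (etaExponent a b c d + n) =
        c * (c ^ 2 - 1) * (-n * (2 * b + n * a)) := by
      rw [etaExponent, etaExponent]
      linear_combination (-n * (c ^ 2 - 1)) * hdet
    rw [this]
    exact (Int.twentyFour_dvd_mul_sq_sub_one hc2).mul_right _
  rw [h1, hJ, hE]
  ring

lemma etaTransforms_one {a b d : ℤ} (hdet : a * d - b * 1 = 1) : EtaTransforms a b 1 d := by
  intro z hz
  have hz' : 0 < (z + d).im := by simpa using hz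
  have h0 : z + d ≠ 0 := by intro h; rw [h] at hz'; simp at hz'
  have e : (a * z + b : ℂ) / ((1 : ℤ) * z + d) = -1 / (z + d) + a := by
    have : (a * d - b * 1 : ℂ) = 1 := by exact_mod_cast hdet
    push_cast
    rw [one_mul]
    field_simp
    linear_combination -this
  rw [e, eta_add_intCast, eta_neg_inv hz', eta_add_intCast]
  have hE : etaExponent a b 1 d = a + -3 + d := by rw [etaExponent]; ring
  rw [hE, zeta24_add, zeta24_add]
  simp
  ring

/-- The transformation law of `η` for matrices with odd positive lower left entry. -/
theorem etaTransforms_of_odd {a b c d : ℤ} (hdet : a * d - b * c = 1) (hc : 0 < c) (hc2 : Odd c) :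
    EtaTransforms a b c d := by
  induction hn : c.toNat using Nat.strong_induction_on generalizing a b c d with
  | _ N ih =>
    obtain rfl | hc1 : c = 1 ∨ 1 < c := by omega
    · exact etaTransforms_one hdet
    -- Euclidean step with an odd remainder, so that `S` leads again to an odd lower left entry. As
    -- `c` is odd, one of `d % c` and `d % c - c` is odd.
    obtain ⟨n, hodd, hlt⟩ : ∃ n : ℤ, Odd (d + n * c) ∧ |d + n * c| < c := by
      have h1 := Int.emod_nonneg d hc.ne'
      have h2 := Int.emod_lt_of_pos d hc
      have h3 := Int.emod_add_mul_ediv d c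
      rcases Int.even_or_odd (d % c) with he | ho
      · have h4 : d + (-(d / c) - 1) * c = d % c - c := by linear_combination -h3
        have h5 : d % c ≠ 0 := by
          intro h5
          obtain ⟨e, rfl⟩ := Int.dvd_of_emod_eq_zero h5
          have : c ∣ 1 := ⟨a * e - b, by linear_combination -hdet⟩
          have := Int.le_of_dvd one_pos this
          omega
        exact ⟨-(d / c) - 1, by rw [h4]; exact he.sub_odd hc2, by rw [h4, abs_lt]; omega⟩
      · have h4 : d + -(d / c) * c = d % c := by linear_combination -h3
        exact ⟨-(d / c), by rwa [h4], by rw [h4, abs_lt]; omega⟩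
    have hdet' : a * (d + n * c) - (b + n * a) * c = 1 := by linear_combination hdet
    suffices EtaTransforms a (b + n * a) c (d + n * c) by
      simpa [add_assoc, ← add_mul] using this.add_mul hdet' hc2 (-n)
    generalize d + n * c = d' at *
    generalize b + n * a = b' at *
    rw [abs_lt] at hlt
    obtain hd | hd : 0 < d' ∨ d' < 0 := by
      rcases lt_trichotomy d' 0 with h | h | h
      · exact Or.inr h
      · subst h; simp at hodd
      · exact Or.inl h
    · rw [← etaTransforms_S_iff hdet' hc hd hc2 hodd]
      exact ih d'.toNat (by omega) (by linear_combination hdet') hd hodd rfl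
    -- Here `S⁻¹` replaces `S`, which makes the new lower left entry `-d'` positive.
    · have h1 : EtaTransforms (-b') a (-d') c :=
        ih (-d').toNat (by omega) (by linear_combination hdet') (by omega) hodd.neg rfl
      simpa using (etaTransforms_S_iff (a := -b') (b := a) (c := -d') (d := c)
        (by linear_combination hdet') (by omega) hc hodd.neg hc2).mpr h1

/-! ### Invariance under `Γ₁(p)`. -/

lemma Nat.Prime.mod_twentyFour {p : ℕ} (hp : p.Prime) (hp3 : 3 < p) :
    p % 24 = 1 ∨ p % 24 = 5 ∨ p % 24 = 7 ∨ p % 24 = 11 ∨ p % 24 = 13 ∨ p % 24 = 17 ∨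
      p % 24 = 19 ∨ p % 24 = 23 := by
  have h2 : ¬ 2 ∣ p := fun h ↦ by
    have := (Nat.prime_dvd_prime_iff_eq Nat.prime_two hp).mp h
    omega
  have h3 : ¬ 3 ∣ p := fun h ↦ by
    have := (Nat.prime_dvd_prime_iff_eq Nat.prime_three hp).mp h
    omega
  omega

lemma Nat.Prime.twentyFour_dvd_sq_sub_one {p : ℕ} (hp : p.Prime) (hp3 : 3 < p) :
    (24 : ℤ) ∣ (p : ℤ) ^ 2 - 1 := by
  have h : (p : ℤ) % 24 = (p % 24 : ℕ) := by simp
  apply Int.dvd_of_emod_eq_zero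
  rcases hp.mod_twentyFour hp3 with e | e | e | e | e | e | e | e <;> rw [e] at h <;>
    simp [Int.sub_emod, pow_two, Int.mul_emod, h]

lemma zpow_eq_one_of_sq_eq_one {x : ℂ} (hx : x ^ 2 = 1) (k : ℤ) : x ^ (2 * k) = 1 := by
  rw [zpow_mul, zpow_ofNat, hx, one_zpow]

/-- The product `η(z)^r η(pz)^s` transforms with trivial character under matrices in `Γ₁(p)` with
odd positive lower left entry. -/
lemma eta_zpow_mul_eta_zpow_moebius {p : ℕ} (hp : p.Prime) (hp3 : 3 < p) {r s k : ℤ}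
    (hrs : r + s = 2 * k) (h24 : 24 ∣ r + p * s) {a b c d : ℤ} (hdet : a * d - b * c = 1)
    (hc : 0 < c) (hc2 : Odd c) (hpc : (p : ℤ) ∣ c) (hpd : (p : ℤ) ∣ d - 1) {z : ℂ}
    (hz : 0 < z.im) :
    ModularForm.eta ((a * z + b) / (c * z + d)) ^ r *
      ModularForm.eta (p * ((a * z + b) / (c * z + d))) ^ s =
    (c * z + d) ^ k * (ModularForm.eta z ^ r * ModularForm.eta (p * z) ^ s) := by
  have hp0 : (0 : ℤ) < p := by exact_mod_cast hp.pos
  obtain ⟨e, rfl⟩ := hpc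
  have he : 0 < e := pos_of_mul_pos_right hc hp0.le
  have he2 : Odd e := (Int.odd_mul.mp hc2).2
  have hcz : (((p * e : ℤ) : ℂ) * z + d) ≠ 0 := by
    intro h
    have := congrArg Complex.im h
    rw [Complex.add_im, Complex.intCast_im, add_zero, ← Complex.ofReal_intCast,
      Complex.im_ofReal_mul] at this
    have h1 : (0 : ℝ) < (p * e : ℤ) := by exact_mod_cast hc
    exact (mul_pos h1 hz).ne' this
  have hpz : 0 < ((p : ℂ) * z).im := by
    rw [← Complex.ofReal_natCast, Complex.im_ofReal_mul]
    exact mul_pos (by exact_mod_cast hp.pos) hz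
  have h1 := etaTransforms_of_odd hdet hc hc2 z hz
  -- Conjugation by `diag(p, 1)` gives `p · γz = γ'(pz)` with this matrix `γ'`.
  have h2 := etaTransforms_of_odd (a := a) (b := p * b) (c := e) (d := d)
    (by linear_combination hdet) he he2 _ hpz
  have e1 : (e * (p * z) + d : ℂ) = ((p * e : ℤ) : ℂ) * z + d := by push_cast; ring
  have e2 : (a * (p * z) + (p * b : ℤ)) / (((p * e : ℤ) : ℂ) * z + d) =
      p * ((a * z + b) / (((p * e : ℤ) : ℂ) * z + d)) := by
    push_cast; ring
  rw [e1, e2] at h2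
  have hJ : jacobiSym d (p * e : ℤ).natAbs = jacobiSym d e.natAbs := by
    have hp1 : jacobiSym d p = 1 := by
      rw [jacobiSym.mod_left' (Int.emod_eq_emod_iff_emod_sub_eq_zero.mpr
        (Int.emod_eq_zero_of_dvd hpd)), jacobiSym.one_left]
    rw [Int.natAbs_mul, Int.natAbs_natCast, jacobiSym.mul_right' _ hp.ne_zero (by omega), hp1,
      one_mul]
  have hcop : d.gcd e.natAbs = 1 := by
    have : IsCoprime d e := ⟨a, -b * p, by linear_combination hdet⟩
    rw [Int.isCoprime_iff_gcd_eq_one] at this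
    rw [Int.gcd, Int.natAbs_natCast]
    exact this
  have hJ2 : (jacobiSym d e.natAbs : ℂ) ^ 2 = 1 := by exact_mod_cast jacobiSym.sq_one hcop
  have hJ0 : (jacobiSym d e.natAbs : ℂ) ≠ 0 := by intro h; simp [h] at hJ2
  have hE : zeta24 (etaExponent a b (p * e) d) ^ r * zeta24 (etaExponent a (p * b) e d) ^ s = 1 := by
    rw [zeta24_zpow, zeta24_zpow, ← zeta24_add]
    apply zeta24_of_dvd
    -- Modulo `p² - 1`, hence modulo 24, the exponent of the conjugated matrix is `p` times that of
    -- the original one.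
    have : etaExponent a b (p * e) d * r + etaExponent a (p * b) e d * s =
        etaExponent a b (p * e) d * (r + p * s) + ((p : ℤ) ^ 2 - 1) *
          (-s * ((a + d) * e - 3 * e - p * b * d * e ^ 2)) := by
      rw [etaExponent, etaExponent]
      ring
    rw [this]
    exact (h24.mul_left _).add ((hp.twentyFour_dvd_sq_sub_one hp3).mul_right _)
  have hs0 : Complex.sqrt (((p * e : ℤ) : ℂ) * z + d) ≠ 0 := by
    intro h
    have := Complex.sqrt_mul_self (((p * e : ℤ) : ℂ) * z + d)
    rw [h, zero_mul] at this
    exact hcz this.symm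
  have hs : Complex.sqrt (((p * e : ℤ) : ℂ) * z + d) ^ r *
      Complex.sqrt (((p * e : ℤ) : ℂ) * z + d) ^ s = (((p * e : ℤ) : ℂ) * z + d) ^ k := by
    rw [← zpow_add₀ hs0, hrs, zpow_mul, zpow_ofNat, sq, Complex.sqrt_mul_self]
  have hJrs : (jacobiSym d e.natAbs : ℂ) ^ r * (jacobiSym d e.natAbs : ℂ) ^ s = 1 := by
    rw [← zpow_add₀ hJ0, hrs, zpow_eq_one_of_sq_eq_one hJ2]
  rw [h1, h2, hJ]
  simp only [mul_zpow]
  rw [← hs]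
  linear_combination (zeta24 (etaExponent a b (p * e) d) ^ r *
    zeta24 (etaExponent a (p * b) e d) ^ s * (Complex.sqrt (((p * e : ℤ) : ℂ) * z + d) ^ r *
      Complex.sqrt (((p * e : ℤ) : ℂ) * z + d) ^ s) * ModularForm.eta z ^ r *
      ModularForm.eta (p * z) ^ s) * hJrs + (Complex.sqrt (((p * e : ℤ) : ℂ) * z + d) ^ r *
      Complex.sqrt (((p * e : ℤ) : ℂ) * z + d) ^ s * ModularForm.eta z ^ r *
      ModularForm.eta (p * z) ^ s) * hE

/-- The function `η(z)^r η(pz)^s` on the upper half-plane. -/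
noncomputable def etaPair (p : ℕ) (r s : ℤ) (z : ℍ) : ℂ :=
  ModularForm.eta z ^ r * ModularForm.eta (p * z) ^ s

open ModularForm in
lemma etaPair_slash_of_odd {p : ℕ} (hp : p.Prime) (hp3 : 3 < p) {r s k : ℤ}
    (hrs : r + s = 2 * k) (h24 : 24 ∣ r + p * s) {γ : SL(2, ℤ)} (hc : 0 < γ 1 0)
    (hc2 : Odd (γ 1 0)) (hpc : (p : ℤ) ∣ γ 1 0) (hpd : (p : ℤ) ∣ γ 1 1 - 1) :
    etaPair p r s ∣[k] γ = etaPair p r s := by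
  ext z
  rw [ModularForm.slash_action_eq'_iff]
  have hdet : γ 0 0 * γ 1 1 - γ 0 1 * γ 1 0 = 1 := by
    rw [← Matrix.det_fin_two, γ.det_coe]
  have h := eta_zpow_mul_eta_zpow_moebius hp hp3 hrs h24 hdet hc hc2 hpc hpd z.im_pos
  rw [etaPair, etaPair, UpperHalfPlane.coe_specialLinearGroup_apply]
  simpa using h

/-- The lower unipotent matrix with lower left entry `n`. -/
def lowerUnipotent (n : ℤ) : SL(2, ℤ) := ⟨!![1, 0; n, 1], by simp [Matrix.det_fin_two]⟩

lemma coe_lowerUnipotent (n : ℤ) :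
    (lowerUnipotent n : Matrix (Fin 2) (Fin 2) ℤ) = !![1, 0; n, 1] := rfl

lemma lowerUnipotent_mul (m n : ℤ) :
    lowerUnipotent m * lowerUnipotent n = lowerUnipotent (m + n) := by
  ext i j
  fin_cases i <;> fin_cases j <;>
    simp [Matrix.SpecialLinearGroup.coe_mul, coe_lowerUnipotent, Matrix.mul_apply]

lemma lowerUnipotent_zero : lowerUnipotent 0 = 1 := by
  ext i j
  fin_cases i <;> fin_cases j <;> simp [lowerUnipotent]

open ModularForm in
-- These matrices serve to make the lower left entry of an element of `Γ₁(p)` odd and positive.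
lemma etaPair_slash_lowerUnipotent {p : ℕ} (hp : p.Prime) (hp3 : 3 < p) {r s k : ℤ}
    (hrs : r + s = 2 * k) (h24 : 24 ∣ r + p * s) (n : ℤ) :
    etaPair p r s ∣[k] lowerUnipotent (p * n) = etaPair p r s := by
  have hp2 : Odd (p : ℤ) := by exact_mod_cast hp.odd_of_ne_two (by omega)
  have hodd {n : ℤ} (hn : 0 < n) (hn2 : Odd n) :
      etaPair p r s ∣[k] lowerUnipotent (p * n) = etaPair p r s :=
    etaPair_slash_of_odd hp hp3 hrs h24
      (by simpa [lowerUnipotent] using mul_pos (show (0 : ℤ) < p by exact_mod_cast hp.pos) hn)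
      (by simpa [lowerUnipotent] using hp2.mul hn2) (by simp [lowerUnipotent])
      (by simp [lowerUnipotent])
  have hpos {n : ℤ} (hn : 0 < n) :
      etaPair p r s ∣[k] lowerUnipotent (p * n) = etaPair p r s := by
    rcases Int.even_or_odd n with he | ho
    · have h1 : n = (n - 1) + 1 := by ring
      have h2 : 0 < n - 1 := by
        obtain ⟨m, rfl⟩ := he
        omega
      rw [h1, mul_add, ← lowerUnipotent_mul, SlashAction.slash_mul,
        hodd h2 (he.sub_odd odd_one), hodd one_pos odd_one]
    · exact hodd hn ho
  rcases lt_trichotomy n 0 with h | rfl | h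
  · have h1 := hpos (neg_pos.mpr h)
    rw [← h1, ← SlashAction.slash_mul, lowerUnipotent_mul, ← mul_add, neg_add_cancel, mul_zero,
      lowerUnipotent_zero, SlashAction.slash_one, h1]
  · rw [mul_zero, lowerUnipotent_zero, SlashAction.slash_one]
  · exact hpos h

open ModularForm in
/-- The function `η(z)^r η(pz)^s` is invariant under `Γ₁(p)`. -/
theorem etaPair_slash_Gamma1 {p : ℕ} (hp : p.Prime) (hp3 : 3 < p) {r s k : ℤ}
    (hrs : r + s = 2 * k) (h24 : 24 ∣ r + p * s) {γ : SL(2, ℤ)}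
    (hγ : γ ∈ CongruenceSubgroup.Gamma1 p) : etaPair p r s ∣[k] γ = etaPair p r s := by
  have hp2 : Odd (p : ℤ) := by exact_mod_cast hp.odd_of_ne_two (by omega)
  have hp0 : (0 : ℤ) < p := by exact_mod_cast hp.pos
  obtain ⟨-, hd, hc⟩ := (CongruenceSubgroup.Gamma1_mem p γ).mp hγ
  rw [ZMod.intCast_zmod_eq_zero_iff_dvd] at hc
  have hd' : (p : ℤ) ∣ γ 1 1 - 1 := by
    rw [← ZMod.intCast_zmod_eq_zero_iff_dvd]
    simp [hd]
  have hdet : γ 0 0 * γ 1 1 - γ 0 1 * γ 1 0 = 1 := by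
    rw [← Matrix.det_fin_two, γ.det_coe]
  have hd0 : γ 1 1 ≠ 0 := by
    intro h
    rw [h, zero_sub, dvd_neg] at hd'
    have := Int.le_of_dvd one_pos hd'
    omega
  -- Taking `n` to be `d` times a positive number adds a positive multiple of `p d²` to `c`. The
  -- factor near `2|c|` makes it exceed `|c|`, and its parity is chosen to make the sum odd.
  obtain ⟨n, hn, hn2⟩ : ∃ n : ℤ, 0 < γ 1 0 + γ 1 1 * (p * n) ∧ Odd (γ 1 0 + γ 1 1 * (p * n)) := by
    generalize γ 1 0 = c at *
    generalize γ 1 1 = d at *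
    have hpd : 0 < p * d ^ 2 := by positivity
    rcases Int.even_or_odd c with he | ho
    · have hd2 : Odd d := by
        by_contra h
        rw [Int.not_odd_iff_even] at h
        have := (h.mul_left (γ 0 0)).sub (he.mul_left (γ 0 1))
        rw [hdet] at this
        exact absurd this (by decide)
      refine ⟨d * (2 * |c| + 1), ?_, ?_⟩
      · nlinarith [neg_abs_le c, abs_nonneg c]
      · exact he.add_odd (hd2.mul (hp2.mul (hd2.mul (odd_two_mul_add_one _))))
    · have hc0 : 0 < |c| := abs_pos.mpr (by rintro rfl; simp at ho)
      refine ⟨d * (2 * |c|), ?_, ?_⟩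
      · nlinarith [neg_abs_le c]
      · exact ho.add_even (((even_two_mul _).mul_left d).mul_left _ |>.mul_left d)
  have key : etaPair p r s ∣[k] (γ * lowerUnipotent (p * n)) = etaPair p r s := by
    have h10 : (γ * lowerUnipotent (p * n)) 1 0 = γ 1 0 + γ 1 1 * (p * n) := by
      simp [Matrix.SpecialLinearGroup.coe_mul, coe_lowerUnipotent, Matrix.mul_apply]
    have h11 : (γ * lowerUnipotent (p * n)) 1 1 = γ 1 1 := by
      simp [Matrix.SpecialLinearGroup.coe_mul, coe_lowerUnipotent, Matrix.mul_apply]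
    refine etaPair_slash_of_odd hp hp3 hrs h24 ?_ ?_ ?_ ?_
    · rwa [h10]
    · rwa [h10]
    · rw [h10]
      exact hc.add ((dvd_mul_right _ _).mul_left _)
    · rwa [h11]
  have h := congrArg (fun f : ℍ → ℂ ↦ f ∣[k] lowerUnipotent (p * -n)) key
  rw [← SlashAction.slash_mul, mul_assoc, lowerUnipotent_mul, ← mul_add, add_neg_cancel, mul_zero,
    lowerUnipotent_zero, mul_one, etaPair_slash_lowerUnipotent hp hp3 hrs h24] at h
  exact h

/-! ### Behaviour at the cusps. -/

lemma tendsto_norm_discriminant_mul_exp :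
    Filter.Tendsto (fun z : ℍ ↦ ‖ModularForm.discriminant z‖ * Real.exp (2 * Real.pi * z.im))
      UpperHalfPlane.atImInfty (nhds 1) := by
  have h := ModularForm.tendsto_atImInfty_tprod_one_sub_eta_q_pow.norm
  rw [norm_one] at h
  refine h.congr fun z ↦ ?_
  rw [ModularForm.discriminant_eq_q_prod, norm_mul, Function.Periodic.norm_qParam, mul_right_comm,
    ← Real.exp_add]
  simp

open ModularForm in
lemma discriminant_smul (γ : SL(2, ℤ)) (z : ℍ) :
    ModularForm.discriminant (γ • z) =
      UpperHalfPlane.denom γ z ^ 12 * ModularForm.discriminant z := by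
  have h := congrFun (SlashInvariantForm.slash_action_generators_SL2Z
    discriminant_S_invariant discriminant_T_invariant γ) z
  rw [ModularForm.SL_slash_apply] at h
  have h0 := UpperHalfPlane.denom_ne_zero γ z
  rw [← h, mul_comm, mul_assoc, zpow_neg, zpow_ofNat, inv_mul_cancel₀ (pow_ne_zero _ h0), mul_one]

/-- The affine map `z ↦ αz + β` of the upper half-plane. -/
noncomputable def affineMap (α : {x : ℝ // 0 < x}) (β : ℝ) (z : ℍ) : ℍ := β +ᵥ α • z

lemma coe_affineMap (α : {x : ℝ // 0 < x}) (β : ℝ) (z : ℍ) :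
    (affineMap α β z : ℂ) = (α : ℝ) * z + β := by
  simp [affineMap, add_comm]

lemma im_affineMap (α : {x : ℝ // 0 < x}) (β : ℝ) (z : ℍ) :
    (affineMap α β z).im = α * z.im := by
  simp [affineMap]

lemma tendsto_affineMap (α : {x : ℝ // 0 < x}) (β : ℝ) :
    Filter.Tendsto (affineMap α β) UpperHalfPlane.atImInfty UpperHalfPlane.atImInfty := by
  rw [UpperHalfPlane.atImInfty, Filter.tendsto_comap_iff]
  refine (Filter.Tendsto.const_mul_atTop α.2 Filter.tendsto_comap).congr fun z ↦ ?_
  simp [im_affineMap]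

lemma exists_coe_eq_of_det_eq_one {M : Matrix (Fin 2) (Fin 2) ℤ} (hM : M.det = 1) :
    ∃ γ : SL(2, ℤ), (γ : Matrix (Fin 2) (Fin 2) ℤ) = M :=
  ⟨⟨M, hM⟩, rfl⟩

/-- Multiplication by a prime `p` after an element of `SL(2, ℤ)` is an element of `SL(2, ℤ)` after
an affine map. -/
lemma exists_mul_smul_eq_smul_affineMap {p : ℕ} (hp : p.Prime) (γ : SL(2, ℤ)) :
    ∃ (γ' : SL(2, ℤ)) (α : {x : ℝ // 0 < x}) (β C : ℝ),
      ((α : ℝ) = p ∨ (α : ℝ) = (p : ℝ)⁻¹) ∧ 0 < C ∧ ∀ z : ℍ,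
        (p : ℂ) * (γ • z : ℍ) = (γ' • affineMap α β z : ℍ) ∧
        UpperHalfPlane.denom γ' (affineMap α β z) = C * UpperHalfPlane.denom γ z := by
  have hdet : γ 0 0 * γ 1 1 - γ 0 1 * γ 1 0 = 1 := by
    rw [← Matrix.det_fin_two, γ.det_coe]
  have hp0 : (0 : ℝ) < p := by exact_mod_cast hp.pos
  have hpC : (p : ℂ) ≠ 0 := by exact_mod_cast hp.ne_zero
  by_cases hpc : (p : ℤ) ∣ γ 1 0
  · obtain ⟨e, he⟩ := hpc
    have hdet' : (!![γ 0 0, p * γ 0 1; e, γ 1 1] : Matrix (Fin 2) (Fin 2) ℤ).det = 1 := by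
      rw [Matrix.det_fin_two_of]
      linear_combination hdet + γ 0 1 * he
    obtain ⟨γ', hγ'⟩ := exists_coe_eq_of_det_eq_one hdet'
    refine ⟨γ', ⟨p, hp0⟩, 0, 1, Or.inl rfl, one_pos, fun z ↦ ⟨?_, ?_⟩⟩
    · rw [UpperHalfPlane.coe_specialLinearGroup_apply, UpperHalfPlane.coe_specialLinearGroup_apply,
        coe_affineMap]
      simp [he, hγ']
      ring
    · rw [ModularGroup.denom_apply, ModularGroup.denom_apply, coe_affineMap]
      simp [he, hγ']
      ring
  -- With `up + vc = 1`, the shift `β = vd/p` gives `c(z/p + β) + ud = (cz + d)/p`.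
  · have hcop : IsCoprime (p : ℤ) (γ 1 0) :=
      (Nat.prime_iff_prime_int.mp hp).coprime_iff_not_dvd.mpr hpc
    obtain ⟨u, v, huv⟩ := hcop
    have hdet' : (!![p * γ 0 0, γ 0 1 - γ 0 0 * (v * γ 1 1); γ 1 0, u * γ 1 1] :
        Matrix (Fin 2) (Fin 2) ℤ).det = 1 := by
      rw [Matrix.det_fin_two_of]
      linear_combination hdet + γ 0 0 * γ 1 1 * huv
    have huv' : (u * p + v * γ 1 0 : ℂ) = 1 := by exact_mod_cast huv
    have e1 (z : ℂ) : (γ 1 0 : ℂ) * ((p : ℂ)⁻¹ * z + v * γ 1 1 / p) + u * γ 1 1 =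
        (p : ℂ)⁻¹ * (γ 1 0 * z + γ 1 1) := by
      field_simp
      linear_combination (γ 1 1 : ℂ) * huv'
    obtain ⟨γ', hγ'⟩ := exists_coe_eq_of_det_eq_one hdet'
    refine ⟨γ', ⟨(p : ℝ)⁻¹, inv_pos.mpr hp0⟩, v * γ 1 1 / p, (p : ℝ)⁻¹, Or.inr rfl,
      inv_pos.mpr hp0, fun z ↦ ⟨?_, ?_⟩⟩
    · rw [UpperHalfPlane.coe_specialLinearGroup_apply, UpperHalfPlane.coe_specialLinearGroup_apply,
        coe_affineMap]
      have e2 : (p * γ 0 0 : ℂ) * ((p : ℂ)⁻¹ * z + v * γ 1 1 / p) +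
          (γ 0 1 - γ 0 0 * (v * γ 1 1)) = γ 0 0 * z + γ 0 1 := by
        field_simp
        ring
      simp [hγ', e1, e2]
      rw [← div_div, div_inv_eq_mul]
      ring
    · rw [ModularGroup.denom_apply, ModularGroup.denom_apply, coe_affineMap]
      simpa [hγ'] using e1 z

lemma isBoundedAtImInfty_of_norm_pow {f : ℍ → ℂ} {n : ℕ} (hn : n ≠ 0) {M : ℝ}
    (h : ∀ᶠ z in UpperHalfPlane.atImInfty, ‖f z‖ ^ n ≤ M) :
    UpperHalfPlane.IsBoundedAtImInfty f := by
  refine Asymptotics.IsBigO.of_bound (max M 1) ?_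
  filter_upwards [h] with z hz
  rw [Pi.one_apply, norm_one, mul_one]
  rcases le_total ‖f z‖ 1 with h1 | h1
  · exact h1.trans (le_max_right _ _)
  · exact ((le_self_pow₀ h1 hn).trans hz).trans (le_max_left _ _)

/-- A product of powers of `Δ(z)` and `Δ(αz + β)` with nonnegative order at `∞` is bounded there. -/
lemma eventually_norm_discriminant_zpow_mul_le {r s : ℤ} (α : {x : ℝ // 0 < x}) (β : ℝ)
    (h : 0 ≤ r + (α : ℝ) * s) :
    ∀ᶠ z : ℍ in UpperHalfPlane.atImInfty, ‖ModularForm.discriminant z‖ ^ r *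
      ‖ModularForm.discriminant (affineMap α β z)‖ ^ s ≤ 2 := by
  have h1 := tendsto_norm_discriminant_mul_exp.zpow₀ r (Or.inl one_ne_zero)
  have h2 := (tendsto_norm_discriminant_mul_exp.comp (tendsto_affineMap α β)).zpow₀ s
    (Or.inl one_ne_zero)
  have h3 := h1.mul h2
  rw [one_zpow, one_zpow, mul_one] at h3
  have hexp (x : ℝ) (n : ℤ) : Real.exp x ^ n = Real.exp (n * x) := by
    rw [← Real.rpow_intCast, ← Real.exp_mul, mul_comm]
  -- The product normalised by exponentials tends to 1. The exponential factor is at least 1 because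
  -- the order is nonnegative.
  filter_upwards [h3.eventually_le_const one_lt_two] with z hz
  simp only [Function.comp_apply, im_affineMap, mul_zpow, hexp] at hz
  refine le_trans ?_ hz
  rw [mul_mul_mul_comm, ← Real.exp_add]
  refine le_mul_of_one_le_right (by positivity) (Real.one_le_exp ?_)
  have : r * (2 * Real.pi * z.im) + s * (2 * Real.pi * (α * z.im)) =
      2 * Real.pi * z.im * (r + (α : ℝ) * s) := by ring
  rw [this]
  have := z.im_pos
  positivity

open ModularForm in
/-- The function `η(z)^r η(pz)^s` is bounded at all cusps if its orders there are nonnegative. -/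
lemma isBoundedAtImInfty_etaPair_slash {p : ℕ} (hp : p.Prime) {r s k : ℤ}
    (hrs : r + s = 2 * k) (h1 : 0 ≤ r + p * s) (h2 : 0 ≤ p * r + s) (γ : SL(2, ℤ)) :
    UpperHalfPlane.IsBoundedAtImInfty (etaPair p r s ∣[k] γ) := by
  obtain ⟨γ', α, β, C, hα, hC, h⟩ := exists_mul_smul_eq_smul_affineMap hp γ
  have hp0 : (0 : ℝ) < p := by exact_mod_cast hp.pos
  have hord : 0 ≤ r + (α : ℝ) * s := by
    rcases hα with e | e <;> rw [e]
    · exact_mod_cast h1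
    · have : (r + (p : ℝ)⁻¹ * s) = (p : ℝ)⁻¹ * (p * r + s) := by field_simp
      rw [this]
      exact mul_nonneg (inv_nonneg.mpr hp0.le) (by exact_mod_cast h2)
  -- The automorphy factors cancel because `r + s = 2k`; only `C^(12s)` remains.
  refine isBoundedAtImInfty_of_norm_pow (n := 24) (by norm_num) (M := (C ^ 12) ^ s * 2) ?_
  filter_upwards [eventually_norm_discriminant_zpow_mul_le α β hord] with z hz
  obtain ⟨e1, e2⟩ := h z
  have hd0 := UpperHalfPlane.denom_ne_zero γ z
  have hnd : ‖UpperHalfPlane.denom γ z‖ ≠ 0 := norm_ne_zero_iff.mpr hd0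
  have key : ‖(etaPair p r s ∣[k] γ) z‖ ^ 24 =
      (C ^ 12) ^ s * (‖ModularForm.discriminant z‖ ^ r *
        ‖ModularForm.discriminant (affineMap α β z)‖ ^ s) := by
    have e3 : ‖(etaPair p r s ∣[k] γ) z‖ ^ 24 = ‖ModularForm.discriminant (γ • z)‖ ^ r *
        ‖ModularForm.discriminant (γ' • affineMap α β z)‖ ^ s *
        (‖UpperHalfPlane.denom γ z‖ ^ 24) ^ (-k) := by
      rw [ModularForm.SL_slash_apply, etaPair, e1, ModularForm.discriminant,
        ModularForm.discriminant]
      simp only [norm_mul, norm_zpow, norm_pow]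
      rw [mul_pow, mul_pow]
      simp only [← zpow_natCast, ← zpow_mul]
      ring_nf
    have e4 : ((‖UpperHalfPlane.denom γ z‖ ^ 12) ^ r * (‖UpperHalfPlane.denom γ z‖ ^ 12) ^ s) *
        (‖UpperHalfPlane.denom γ z‖ ^ 24) ^ (-k) = 1 := by
      rw [← zpow_add₀ (pow_ne_zero _ hnd), hrs, zpow_mul, zpow_ofNat, ← pow_mul, zpow_neg]
      exact mul_inv_cancel₀ (zpow_ne_zero _ (pow_ne_zero _ hnd))
    rw [e3, discriminant_smul, discriminant_smul, e2]
    simp only [norm_mul, norm_pow, mul_zpow, mul_pow, Complex.norm_real, Real.norm_of_nonneg hC.le]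
    linear_combination ((C ^ 12) ^ s * (‖ModularForm.discriminant z‖ ^ r *
        ‖ModularForm.discriminant (affineMap α β z)‖ ^ s)) * e4
  rw [key]
  exact mul_le_mul_of_nonneg_left hz (by positivity)

/-! ### Holomorphy and the modular form. -/

lemma mdifferentiable_etaPair {p : ℕ} (hp : 0 < p) (r s : ℤ) :
    MDifferentiable (modelWithCornersSelf ℂ ℂ) (modelWithCornersSelf ℂ ℂ) (etaPair p r s) := by
  rw [UpperHalfPlane.mdifferentiable_iff]
  have hpz {z : ℂ} (hz : 0 < z.im) : 0 < ((p : ℂ) * z).im := by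
    rw [← Complex.ofReal_natCast, Complex.im_ofReal_mul]
    exact mul_pos (by exact_mod_cast hp) hz
  have hd (z : ℂ) (hz : 0 < z.im) : DifferentiableAt ℂ
      (fun z ↦ ModularForm.eta z ^ r * ModularForm.eta (p * z) ^ s) z := by
    have h1 := ModularForm.differentiableAt_eta_of_mem_upperHalfPlaneSet hz
    have h2 := ModularForm.differentiableAt_eta_of_mem_upperHalfPlaneSet (hpz hz)
    have h3 : DifferentiableAt ℂ (fun z ↦ ModularForm.eta (p * z)) z :=
      DifferentiableAt.comp z h2 (by fun_prop)
    -- Negative exponents are harmless because `η` has no zeros.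
    exact (h1.zpow (Or.inl (ModularForm.eta_ne_zero hz))).mul
      (h3.zpow (Or.inl (ModularForm.eta_ne_zero (hpz hz))))
  refine DifferentiableOn.congr (fun z hz ↦ (hd z hz).differentiableWithinAt) fun z hz ↦ ?_
  simp [etaPair, UpperHalfPlane.ofComplex_apply_of_im_pos hz]

/-- The function `η(z)^r η(pz)^s` as a modular form for `Γ₁(p)`. -/
noncomputable def etaPairModularForm {p : ℕ} (hp : p.Prime) (hp3 : 3 < p) {r s k : ℤ}
    (hrs : r + s = 2 * k) (h24 : 24 ∣ r + p * s) (h1 : 0 ≤ r + p * s) (h2 : 0 ≤ p * r + s) :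
    ModularForm ((CongruenceSubgroup.Gamma1 p : Subgroup SL(2, ℤ)) :
        Subgroup (GL (Fin 2) ℝ)) k where
  toFun := etaPair p r s
  slash_action_eq' A hA := by
    obtain ⟨γ, hγ, rfl⟩ := hA
    exact etaPair_slash_Gamma1 hp hp3 hrs h24 hγ
  holo' := mdifferentiable_etaPair hp.pos r s
  bdd_at_cusps' hc := by
    have : NeZero p := ⟨hp.ne_zero⟩
    have := (CongruenceSubgroup.Gamma1_is_congruence p).finiteIndex
    rw [Subgroup.IsArithmetic.isCusp_iff_isCusp_SL2Z] at hc
    rw [OnePoint.isBoundedAt_iff_forall_SL2Z hc]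
    exact fun γ _ ↦ isBoundedAtImInfty_etaPair_slash hp hrs h1 h2 γ

lemma isEtaQuotient_etaPair {p : ℕ} (hp : p.Prime) (r s : ℤ) :
    IsEtaQuotient p (etaPair p r s) := by
  refine ⟨hp.one_le, fun δ ↦ if δ = 1 then r else s, ?_⟩
  ext z
  rw [etaQuotient, hp.divisors, Finset.prod_pair hp.one_lt.ne]
  simp [etaPair, hp.one_lt.ne']

/-! ### Existence of the exponents. -/

/-- If `2hL = p - 1`, `hm = 12` and `L` is invertible modulo `m`, then exponents of a holomorphic
eta-quotient of weight `k` exist as soon as `h ∣ k` and `12L ≤ k(p + 1)`. -/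
lemma exists_eta_exponents {p k h L m t u : ℤ} (hL : 0 < L) (hp : p - 1 = 2 * h * L)
    (hhm : h * m = 12) (htu : t * L = 1 + m * u) (hk : h ∣ k) (hle : 12 * L ≤ k * (p + 1)) :
    ∃ r s : ℤ, r + s = 2 * k ∧ 24 ∣ r + p * s ∧ 0 ≤ r + p * s ∧ 0 ≤ p * r + s := by
  obtain ⟨l, rfl⟩ := hk
  -- For `s = -lt - mq` one finds `r + ps = -24(lu + Lq)`; this `q` turns it into `24a` with `0 ≤ a
  -- < L`.
  set q := (-(l * u)) / L with hq
  have e1 : (-(l * u)) % L + L * q = -(l * u) := Int.emod_add_mul_ediv _ _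
  have e2 := Int.emod_nonneg (-(l * u)) hL.ne'
  have e3 := Int.emod_lt_of_pos (-(l * u)) hL
  generalize (-(l * u)) % L = a at *
  have key : 2 * (h * l) - (-(l * t) - m * q) + p * (-(l * t) - m * q) = 24 * a := by
    linear_combination (-(l * t) - m * q) * hp - 2 * h * l * htu - 24 * e1 -
      2 * (L * q + l * u) * hhm
  refine ⟨2 * (h * l) - (-(l * t) - m * q), -(l * t) - m * q, by ring, ?_, ?_, ?_⟩
  · exact ⟨a, key⟩
  · rw [key]
    omega
  · have : p * (2 * (h * l) - (-(l * t) - m * q)) + (-(l * t) - m * q) =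
        2 * (h * l * (p + 1)) - 24 * a := by linear_combination -key
    rw [this]
    omega

lemma exists_eta_exponents_of_prime {p : ℕ} (hp : p.Prime) (hp3 : 3 < p) {k : ℤ}
    (hk : (weightDivisor p : ℤ) ∣ k)
    (hle : ((p : ℝ) - 1) / (2 * (weightDivisor p : ℝ)) ≤ (k : ℝ) * ((p : ℝ) + 1) / 12) :
    ∃ r s : ℤ, r + s = 2 * k ∧ 24 ∣ r + p * s ∧ 0 ≤ r + p * s ∧ 0 ≤ p * r + s := by
  have main (h L m t u : ℤ) (hw : (weightDivisor p : ℤ) = h) (hm : 0 < m)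
      (hpL : (p : ℤ) - 1 = 2 * h * L) (hhm : h * m = 12) (htu : t * L = 1 + m * u) :
      ∃ r s : ℤ, r + s = 2 * k ∧ 24 ∣ r + p * s ∧ 0 ≤ r + p * s ∧ 0 ≤ p * r + s := by
    have hh : 0 < h := pos_of_mul_pos_left (by omega) hm.le
    have hL : 0 < L := pos_of_mul_pos_right (a := 2 * h) (by omega) (by omega)
    refine exists_eta_exponents hL hpL hhm htu (hw ▸ hk) ?_
    have hwR : (weightDivisor p : ℝ) = h := by exact_mod_cast hw
    have hpR : (p : ℝ) - 1 = 2 * h * L := by exact_mod_cast hpL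
    have hhR : (2 * h : ℝ) ≠ 0 := by
      have : (h : ℝ) ≠ 0 := by exact_mod_cast hh.ne'
      positivity
    rw [hwR, hpR, mul_div_cancel_left₀ _ hhR, le_div_iff₀ (by norm_num), mul_comm] at hle
    exact_mod_cast hle
  have hdiv := Nat.div_add_mod p 24
  set n := p / 24
  -- Units modulo a divisor of 12 are their own inverses, so `t` is the residue of `L` modulo `m =
  -- 12/h`.
  rcases hp.mod_twentyFour hp3 with e | e | e | e | e | e | e | e <;> rw [e] at hdiv
  · exact main 12 n 1 0 (-1) (by simp [weightDivisor, e]) (by norm_num) (by omega) (by norm_num)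
      (by ring)
  · exact main 2 (6 * n + 1) 6 1 n (by simp [weightDivisor, e]) (by norm_num) (by omega)
      (by norm_num) (by ring)
  · exact main 3 (4 * n + 1) 4 1 n (by simp [weightDivisor, e]) (by norm_num) (by omega)
      (by norm_num) (by ring)
  · exact main 1 (12 * n + 5) 12 5 (5 * n + 2) (by simp [weightDivisor, e]) (by norm_num)
      (by omega) (by norm_num) (by ring)
  · exact main 6 (2 * n + 1) 2 1 n (by simp [weightDivisor, e]) (by norm_num) (by omega)
      (by norm_num) (by ring)
  · exact main 4 (3 * n + 2) 3 2 (2 * n + 1) (by simp [weightDivisor, e]) (by norm_num)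
      (by omega) (by norm_num) (by ring)
  · exact main 3 (4 * n + 3) 4 3 (3 * n + 2) (by simp [weightDivisor, e]) (by norm_num)
      (by omega) (by norm_num) (by ring)
  · exact main 1 (12 * n + 11) 12 11 (11 * n + 10) (by simp [weightDivisor, e]) (by norm_num)
      (by omega) (by norm_num) (by ring)

theorem mainTheorem8 (p : ℕ) (hp : p.Prime) (hp3 : 3 < p) (k : ℤ)
    (hk : (weightDivisor p : ℤ) ∣ k)
    (hle : ((p : ℝ) - 1) / (2 * (weightDivisor p : ℝ)) ≤ (k : ℝ) * ((p : ℝ) + 1) / 12) :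
    ∃ f : ModularForm ((CongruenceSubgroup.Gamma1 p : Subgroup SL(2, ℤ)) :
        Subgroup (GL (Fin 2) ℝ)) k,
      IsEtaQuotient p (f : ℍ → ℂ) := by
  obtain ⟨r, s, hrs, h24, h1, h2⟩ := exists_eta_exponents_of_prime hp hp3 hk hle
  exact ⟨etaPairModularForm hp hp3 hrs h24 h1 h2, isEtaQuotient_etaPair hp r s⟩
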